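/- **Setting.** Let $A$ and $B$ be unital complex Banach algebras and let $M$ be a unital Banach $A$-$B$-bimodule. A Banach $A$-$B$-bimodule is here a Banach space with commuting bilinear actions satisfying $\|am\|\le\|a\|\|m\|$ and $\|mb\|\le\|m\|\|b\|$; it is unital if $1_Am=m=m1_B$. For any Banach $A$-$B$-bimodule $N$, unital or not, let $$\begin{bmatrix}A&N\\0&B\end{bmatrix}=\Big\{\begin{bmatrix}a&x\\0&b\end{bmatrix}:a\in A,\ x\in N,\ b\in B\Big\}$$ be the Banach algebra with the formal matrix operations and the norm $\|a\|+\|x\|+\|b\|$. It is itself a Banach $A$-$B$-bimodule, by matrix multiplication with its corners $A$ and $B$: $$a'\cdot\begin{bmatrix}a&x\\0&b\end{bmatrix}=\begin{bmatrix}a'a&a'x\\0&0\end{bmatrix},\qquad \begin{bmatrix}a&x\\0&b\end{bmatrix}\cdot b'=\begin{bmatrix}0&xb'\\0&bb'\end{bmatrix}.$$ (This bimodule structure on the algebra is in general not unital.) Put $$\mathcal T=\mathcal T_0=\begin{bmatrix}A&M\\0&B\end{bmatrix},\qquad \mathcal T_m=\begin{bmatrix}A&\mathcal T_{m-1}\\0&B\end{bmatrix}\quad(m\ge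 1).$$ Every Banach $A$-$B$-bimodule $X$ (in particular $X=M$ and $X=\mathcal T_m$) is regarded as a Banach $\mathcal T$-bimodule through the diagonal entries: for $t=\begin{bmatrix}a&m\\0&b\end{bmatrix}\in\mathcal T$ and $x\in X$, $$t\cdot x=ax,\qquad x\cdot t=xb .$$ For a Banach $\mathcal T$-bimodule $X$, $H_n(\mathcal T,X)$ $(n\ge 0)$ denotes the $n$-th homology group (kernel modulo image, with no closure taken) of the complex $0\leftarrow C_0\xleftarrow{d_0}C_1\xleftarrow{d_1}\cdots$, where $C_0=X$, $C_n=\mathcal T\hat\otimes\cdots\hat\otimes\mathcal T\hat\otimes X$ ($n$ factors $\mathcal T$, completed projective tensor products), and $$d_n(t_1\otimes\cdots\otimes t_{n+1}\otimes x)=t_2\otimes\cdots\otimes t_{n+1}\otimes xt_1+\sum_{k=1}^n(-1)^kt_1\otimes\cdots\otimes t_kt_{k+1}\otimes\cdots\otimes t_{n+1}\otimes x+(-1)^{n+1}t_1\otimes\cdots\otimes t_n\otimes t_{n+1}x .$$ **Statement.** $H_n(\mathcal T,M)=0$ for every $n\ge 0$, and $H_n(\mathcal T,\mathcal T_m)=0$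 for all $m\ge 0$ and $n\ge 0$. -/

import Mathlib

open scoped TensorProduct

universe u v w

set_option linter.unusedSectionVars false

noncomputable section

namespace TriBanach

/-! ### The projective tensor product of Banach spaces -/

section Projective

variable (E : Type u) (F : Type v)
  [NormedAddCommGroup E] [NormedSpace ℂ E] [NormedAddCommGroup F] [NormedSpace ℂ F]

/-- The algebraic tensor product, as a type of its own that will carry the projective seminorm. -/
def AlgTensor : Type (max u v) := E ⊗[ℂ] F

instance : AddCommGroup (AlgTensor E F) := inferInstanceAs (AddCommGroup (E ⊗[ℂ] F))

instance : Module ℂ (AlgTensor E F) := inferInstanceAs (Module ℂ (E ⊗[ℂ] F))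

variable {E F}

/-- The elementary tensor `e ⊗ f`. -/
def AlgTensor.tmul (e : E) (f : F) : AlgTensor E F := (e ⊗ₜ[ℂ] f : E ⊗[ℂ] F)

/-- The element `∑ eᵢ ⊗ fᵢ` given by a list of pairs. -/
def tensorSum (l : List (E × F)) : AlgTensor E F :=
  (l.map fun p => AlgTensor.tmul p.1 p.2).sum

/-- The number `∑ ‖eᵢ‖ ‖fᵢ‖` given by a list of pairs. -/
def normSum (l : List (E × F)) : ℝ := (l.map fun p => ‖p.1‖ * ‖p.2‖).sum

/-- The projective seminorm: the infimum of `∑ ‖eᵢ‖ ‖fᵢ‖` over all finite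
representations `z = ∑ eᵢ ⊗ fᵢ`. -/
def projNorm (z : AlgTensor E F) : ℝ := sInf {r | ∃ l : List (E × F), tensorSum l = z ∧ normSum l = r}

theorem tensorSum_append (l l' : List (E × F)) :
    tensorSum (l ++ l') = tensorSum l + tensorSum l' := by
  simp [tensorSum]

theorem normSum_append (l l' : List (E × F)) : normSum (l ++ l') = normSum l + normSum l' := by
  simp [normSum]

theorem normSum_nonneg (l : List (E × F)) : 0 ≤ normSum l := by
  apply List.sum_nonneg
  simp only [List.mem_map]
  rintro _ ⟨p, -, rfl⟩
  positivity

theorem tensorSum_smul (c : ℂ) (l : List (E × F)) :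
    tensorSum (l.map fun p => (c • p.1, p.2)) = c • tensorSum l := by
  induction l with
  | nil => simp [tensorSum]
  | cons p l ih =>
    simp only [tensorSum, List.map_cons, List.sum_cons, smul_add] at ih ⊢
    rw [ih]; rfl

theorem normSum_smul (c : ℂ) (l : List (E × F)) :
    normSum (l.map fun p => (c • p.1, p.2)) = ‖c‖ * normSum l := by
  induction l with
  | nil => simp [normSum]
  | cons p l ih =>
    simp only [normSum, List.map_cons, List.sum_cons, norm_smul] at ih ⊢
    rw [ih]; ring

theorem exists_tensorSum (z : AlgTensor E F) : ∃ l : List (E × F), tensorSum l = z := by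
  induction z using TensorProduct.induction_on with
  | zero => exact ⟨[], rfl⟩
  | tmul e f => exact ⟨[(e, f)], add_zero (e ⊗ₜ[ℂ] f)⟩
  | add x y hx hy =>
    obtain ⟨l, rfl⟩ := hx
    obtain ⟨l', rfl⟩ := hy
    exact ⟨l ++ l', tensorSum_append l l'⟩

theorem projNorm_le (l : List (E × F)) : projNorm (tensorSum l) ≤ normSum l :=
  csInf_le ⟨0, by rintro _ ⟨l, -, rfl⟩; exact normSum_nonneg l⟩ ⟨l, rfl, rfl⟩

theorem le_projNorm {z : AlgTensor E F} {r : ℝ}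
    (h : ∀ l : List (E × F), tensorSum l = z → r ≤ normSum l) : r ≤ projNorm z := by
  obtain ⟨l, hl⟩ := exists_tensorSum z
  refine le_csInf ⟨_, l, hl, rfl⟩ ?_
  rintro _ ⟨l, hl, rfl⟩
  exact h l hl

theorem projNorm_smul_le (c : ℂ) (z : AlgTensor E F) : projNorm (c • z) ≤ ‖c‖ * projNorm z := by
  have key : ∀ l : List (E × F), tensorSum l = z → projNorm (c • z) ≤ ‖c‖ * normSum l := by
    rintro l rfl
    rw [← tensorSum_smul, ← normSum_smul]
    exact projNorm_le _
  rcases (norm_nonneg c).eq_or_lt with h0 | h0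
  · obtain ⟨l, hl⟩ := exists_tensorSum z
    simpa [← h0] using key l hl
  · rw [← div_le_iff₀' h0]
    exact le_projNorm fun l hl => by rw [div_le_iff₀' h0]; exact key l hl

theorem projNorm_add_le (x y : AlgTensor E F) : projNorm (x + y) ≤ projNorm x + projNorm y := by
  rw [← sub_le_iff_le_add]
  refine le_projNorm fun l hl => ?_
  rw [sub_le_comm]
  refine le_projNorm fun l' hl' => ?_
  rw [sub_le_iff_le_add, ← normSum_append, ← hl, ← hl', add_comm, ← tensorSum_append]
  exact (projNorm_le _).trans_eq (by simp only [normSum_append, add_comm])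

variable (E F) in
/-- The projective seminorm as a seminorm on the additive group. -/
def projSeminorm : AddGroupSeminorm (AlgTensor E F) where
  toFun := projNorm
  map_zero' := le_antisymm (projNorm_le []) (le_projNorm fun l _ => normSum_nonneg l)
  add_le' := projNorm_add_le
  neg' z := by
    have h : ∀ z : AlgTensor E F, projNorm (-z) ≤ projNorm z := fun z => by
      simpa using projNorm_smul_le (-1) z
    exact le_antisymm (h z) (by simpa using h (-z))

instance : SeminormedAddCommGroup (AlgTensor E F) :=
  (projSeminorm E F).toSeminormedAddCommGroup

instance : NormedSpace ℂ (AlgTensor E F) where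
  norm_smul_le := projNorm_smul_le

variable (E F) in
/-- The projective tensor product of two Banach spaces: the completion of the algebraic tensor
product for the projective seminorm. -/
def ProjTensor : Type (max u v) := UniformSpace.Completion (AlgTensor E F)

instance : NormedAddCommGroup (ProjTensor E F) :=
  inferInstanceAs (NormedAddCommGroup (UniformSpace.Completion (AlgTensor E F)))

instance : NormedSpace ℂ (ProjTensor E F) :=
  inferInstanceAs (NormedSpace ℂ (UniformSpace.Completion (AlgTensor E F)))

instance : CompleteSpace (ProjTensor E F) :=
  inferInstanceAs (CompleteSpace (UniformSpace.Completion (AlgTensor E F)))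

variable (E F) in
/-- The canonical map from the algebraic tensor product to its completion. -/
def toProj : AlgTensor E F →L[ℂ] ProjTensor E F :=
  (UniformSpace.Completion.toComplL : AlgTensor E F →L[ℂ] UniformSpace.Completion (AlgTensor E F))

theorem norm_toProj (z : AlgTensor E F) : ‖toProj E F z‖ = ‖z‖ :=
  UniformSpace.Completion.norm_coe z

theorem denseRange_toProj : DenseRange (toProj E F) := UniformSpace.Completion.denseRange_coe

theorem norm_algTmul_le (e : E) (f : F) : ‖AlgTensor.tmul e f‖ ≤ ‖e‖ * ‖f‖ := by
  have h := projNorm_le [(e, f)]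
  simp only [tensorSum, normSum, List.map_cons, List.map_nil, List.sum_cons, List.sum_nil,
    add_zero] at h
  exact h

/-- The algebraic bilinear map `(e, f) ↦ e ⊗ f`. -/
def algMk : E →ₗ[ℂ] F →ₗ[ℂ] AlgTensor E F := (TensorProduct.mk ℂ E F : E →ₗ[ℂ] F →ₗ[ℂ] E ⊗[ℂ] F)

/-- The canonical bounded bilinear map `(e, f) ↦ e ⊗ f`. -/
def tmulL : E →L[ℂ] F →L[ℂ] ProjTensor E F :=
  LinearMap.mkContinuous₂
    (algMk.compr₂ (toProj E F).toLinearMap) 1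
    fun e f => by
      rw [one_mul]
      exact (norm_toProj _).trans_le (norm_algTmul_le e f)

theorem tmulL_apply (e : E) (f : F) : tmulL e f = toProj E F (AlgTensor.tmul e f) := rfl

variable {G : Type w} [NormedAddCommGroup G] [NormedSpace ℂ G]

/-- The linear map on the algebraic tensor product given by a bounded bilinear map. -/
def algLiftₗ (β : E →L[ℂ] F →L[ℂ] G) : AlgTensor E F →ₗ[ℂ] G :=
  (TensorProduct.lift ((ContinuousLinearMap.coeLM ℂ).comp β.toLinearMap) : E ⊗[ℂ] F →ₗ[ℂ] G)

theorem algLiftₗ_tmul (β : E →L[ℂ] F →L[ℂ] G) (e : E) (f : F) :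
    algLiftₗ β (AlgTensor.tmul e f) = β e f := TensorProduct.lift.tmul e f

theorem norm_algLiftₗ_le (β : E →L[ℂ] F →L[ℂ] G) (z : AlgTensor E F) :
    ‖algLiftₗ β z‖ ≤ ‖β‖ * ‖z‖ := by
  have key : ∀ l : List (E × F), ‖algLiftₗ β (tensorSum l)‖ ≤ ‖β‖ * normSum l := by
    intro l
    induction l with
    | nil => simp [tensorSum, normSum]
    | cons p l ih =>
      simp only [tensorSum, normSum, List.map_cons, List.sum_cons, map_add, mul_add,
        algLiftₗ_tmul, ← mul_assoc] at ih ⊢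
      exact (norm_add_le _ _).trans (add_le_add (β.le_opNorm₂ p.1 p.2) ih)
  rcases (norm_nonneg β).eq_or_lt with h0 | h0
  · obtain ⟨l, rfl⟩ := exists_tensorSum z
    have := key l
    rwa [← h0, zero_mul] at this ⊢
  · rw [← div_le_iff₀' h0]
    exact le_projNorm fun l hl => by rw [div_le_iff₀' h0, ← hl]; exact key l

/-- The bounded map on the algebraic tensor product given by a bounded bilinear map. -/
def algLift (β : E →L[ℂ] F →L[ℂ] G) : AlgTensor E F →L[ℂ] G :=
  (algLiftₗ β).mkContinuous ‖β‖ (norm_algLiftₗ_le β)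

theorem hom_ext {S T : ProjTensor E F →L[ℂ] G} (h : ∀ e f, S (tmulL e f) = T (tmulL e f)) :
    S = T := by
  have key : ∀ z : AlgTensor E F, S (toProj E F z) = T (toProj E F z) := by
    intro z
    obtain ⟨l, rfl⟩ := exists_tensorSum z
    induction l with
    | nil => simp [tensorSum]
    | cons p l ih =>
      have h' := h p.1 p.2
      rw [tmulL_apply] at h'
      simp only [tensorSum, List.map_cons, List.sum_cons, map_add] at ih ⊢
      rw [h', ih]
  ext z
  exact congrFun (denseRange_toProj.equalizer S.continuous T.continuous (funext key)) z

variable [CompleteSpace G]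

/-- The bounded linear map `E ⊗̂ F → G` with `e ⊗ f ↦ β e f`, for a bounded bilinear map `β`. -/
def lift (β : E →L[ℂ] F →L[ℂ] G) : ProjTensor E F →L[ℂ] G :=
  (algLift β).fromCompletion

theorem lift_toProj (β : E →L[ℂ] F →L[ℂ] G) (z : AlgTensor E F) :
    lift β (toProj E F z) = algLiftₗ β z :=
  ContinuousLinearMap.fromCompletion_apply_coe (algLift β) z

@[simp]
theorem lift_tmul (β : E →L[ℂ] F →L[ℂ] G) (e : E) (f : F) : lift β (tmulL e f) = β e f := by
  rw [tmulL_apply, lift_toProj, algLiftₗ_tmul]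

theorem norm_lift_le (β : E →L[ℂ] F →L[ℂ] G) : ‖lift β‖ ≤ ‖β‖ := by
  refine ContinuousLinearMap.opNorm_le_bound _ (norm_nonneg β) fun z => ?_
  induction z using denseRange_toProj.induction_on with
  | hp => exact isClosed_le (by fun_prop) (by fun_prop)
  | ih z =>
    rw [lift_toProj, norm_toProj]
    exact norm_algLiftₗ_le β z

theorem lift_add (β γ : E →L[ℂ] F →L[ℂ] G) : lift (β + γ) = lift β + lift γ :=
  hom_ext fun e f => by simp

theorem lift_smul (c : ℂ) (β : E →L[ℂ] F →L[ℂ] G) : lift (c • β) = c • lift β :=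
  hom_ext fun e f => by simp

theorem continuous_lift :
    Continuous (lift : (E →L[ℂ] F →L[ℂ] G) → (ProjTensor E F →L[ℂ] G)) := by
  have h : LipschitzWith 1
      (lift : (E →L[ℂ] F →L[ℂ] G) → (ProjTensor E F →L[ℂ] G)) := by
    refine LipschitzWith.of_dist_le_mul fun β γ => ?_
    have e : lift β - lift γ = lift (β - γ) := hom_ext fun e f => by simp
    rw [dist_eq_norm, dist_eq_norm, NNReal.coe_one, one_mul, e]
    exact norm_lift_le (β - γ)
  exact h.continuous

/-- The assignment `β ↦ lift β`, as a bounded linear map. -/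
def liftL : (E →L[ℂ] F →L[ℂ] G) →L[ℂ] (ProjTensor E F →L[ℂ] G) where
  toFun := lift
  map_add' := lift_add
  map_smul' := lift_smul
  cont := continuous_lift

@[simp]
theorem liftL_apply (β : E →L[ℂ] F →L[ℂ] G) : liftL β = lift β := rfl

/-- The bounded map `id ⊗ S : E ⊗̂ F → E ⊗̂ G`, as a bounded linear function of `S`. -/
def idTensor : (F →L[ℂ] G) →L[ℂ] (ProjTensor E F →L[ℂ] ProjTensor E G) :=
  liftL.comp ((ContinuousLinearMap.compL ℂ F G (ProjTensor E G)).comp tmulL).flip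

@[simp]
theorem idTensor_tmul (S : F →L[ℂ] G) (e : E) (f : F) :
    idTensor S (tmulL e f) = tmulL e (S f) := by
  simp [idTensor]

end Projective

/-! ### Banach spaces and Banach bimodules -/

/-- A complex Banach space, as a bundled object. -/
structure BanachSp where
  /-- The underlying type. -/
  carrier : Type u
  [normed : NormedAddCommGroup carrier]
  [space : NormedSpace ℂ carrier]
  [complete : CompleteSpace carrier]

attribute [instance] BanachSp.normed BanachSp.space BanachSp.complete

/-- A Banach `A`-`B`-bimodule: a Banach space with commuting contractive bilinear actions of `A`
on the left and of `B` on the right. Here `right b x` is `x · b`. The actions need not be unital. -/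
structure BanachBimodule (A : Type u) (B : Type v) [NonUnitalNormedRing A] [NormedSpace ℂ A]
    [NonUnitalNormedRing B] [NormedSpace ℂ B] extends BanachSp.{w} where
  /-- The left action `a ↦ (x ↦ a · x)`. -/
  left : A →L[ℂ] carrier →L[ℂ] carrier
  /-- The right action `b ↦ (x ↦ x · b)`. -/
  right : B →L[ℂ] carrier →L[ℂ] carrier
  left_mul : ∀ a a' x, left (a * a') x = left a (left a' x)
  right_mul : ∀ b b' x, right (b * b') x = right b' (right b x)
  left_right : ∀ a b x, left a (right b x) = right b (left a x)
  norm_left_le : ∀ a x, ‖left a x‖ ≤ ‖a‖ * ‖x‖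
  norm_right_le : ∀ b x, ‖right b x‖ ≤ ‖b‖ * ‖x‖

/-- A bimodule over unital algebras is unital if both units act as the identity. -/
def BanachBimodule.IsUnital {A : Type u} {B : Type v} [NormedRing A] [NormedAlgebra ℂ A]
    [NormedRing B] [NormedAlgebra ℂ B] (M : BanachBimodule.{u, v, w} A B) : Prop :=
  (∀ x, M.left 1 x = x) ∧ ∀ x, M.right 1 x = x

/-! ### The standard homology complex -/

section Homology

variable (A : Type u) [NonUnitalNormedRing A] [NormedSpace ℂ A]

/-- The space of `n`-chains `A ⊗̂ (A ⊗̂ (⋯ ⊗̂ (A ⊗̂ X)))`, with `n` factors `A`. -/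
def chain (X : BanachSp.{u}) : ℕ → BanachSp.{u}
  | 0 => X
  | n + 1 => ⟨ProjTensor A (chain X n).carrier⟩

variable {A}

/-- The bounded bilinear map `(a, c) ↦ a ⊗ c` from `A` and the `n`-chains to the `n + 1`-chains. -/
def cons {X : BanachSp.{u}} (n : ℕ) :
    A →L[ℂ] (chain A X n).carrier →L[ℂ] (chain A X (n + 1)).carrier :=
  (tmulL : A →L[ℂ] (chain A X n).carrier →L[ℂ] ProjTensor A (chain A X n).carrier)

/-- The bounded map on `n + 1`-chains with `a ⊗ c ↦ β a c`, for a bounded bilinear map `β`. -/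
def chainLift {X : BanachSp.{u}} {n : ℕ} {H : Type w} [NormedAddCommGroup H] [NormedSpace ℂ H]
    [CompleteSpace H] (β : A →L[ℂ] (chain A X n).carrier →L[ℂ] H) :
    (chain A X (n + 1)).carrier →L[ℂ] H :=
  (lift β : ProjTensor A (chain A X n).carrier →L[ℂ] H)

/-- The bounded map `id ⊗ S` with `a ⊗ c ↦ a ⊗ S c`, as a bounded linear function of `S`. -/
def idCons {X : BanachSp.{u}} {m n : ℕ} :
    ((chain A X m).carrier →L[ℂ] (chain A X n).carrier) →L[ℂ]
      ((chain A X (m + 1)).carrier →L[ℂ] (chain A X (n + 1)).carrier) :=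
  (idTensor : ((chain A X m).carrier →L[ℂ] (chain A X n).carrier) →L[ℂ]
    (ProjTensor A (chain A X m).carrier →L[ℂ] ProjTensor A (chain A X n).carrier))

@[simp]
theorem chainLift_cons {X : BanachSp.{u}} {n : ℕ} {H : Type w} [NormedAddCommGroup H]
    [NormedSpace ℂ H] [CompleteSpace H] (β : A →L[ℂ] (chain A X n).carrier →L[ℂ] H) (a : A)
    (c : (chain A X n).carrier) : chainLift β (cons n a c) = β a c := lift_tmul _ _ _

@[simp]
theorem idCons_cons {X : BanachSp.{u}} {m n : ℕ}
    (S : (chain A X m).carrier →L[ℂ] (chain A X n).carrier) (a : A)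
    (c : (chain A X m).carrier) : idCons S (cons m a c) = cons n a (S c) := idTensor_tmul _ _ _

theorem chain_hom_ext {Y : BanachSp.{u}} {n : ℕ} {H : Type w} [NormedAddCommGroup H]
    [NormedSpace ℂ H] {S T : (chain A Y (n + 1)).carrier →L[ℂ] H}
    (h : ∀ a c, S (cons n a c) = T (cons n a c)) : S = T := hom_ext h

/-- The elementary tensor `a₁ ⊗ ⋯ ⊗ aₙ ⊗ x`. -/
def elem {X : BanachSp.{u}} : (n : ℕ) → (Fin n → A) → X.carrier → (chain A X n).carrier
  | 0, _, x => x
  | n + 1, a, x => cons n (a 0) (elem n (Fin.tail a) x)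

variable [IsScalarTower ℂ A A] [SMulCommClass ℂ A A] (X : BanachBimodule.{u, u, u} A A)

/-- Left multiplication of `A` on the leftmost tensor factor of a chain:
`a · x` for `n = 0`, and `a · (a₁ ⊗ ⋯ ⊗ x) = (a a₁) ⊗ ⋯ ⊗ x` for `n > 0`. -/
def actLeft : (n : ℕ) → A →L[ℂ] (chain A X.toBanachSp n).carrier →L[ℂ]
    (chain A X.toBanachSp n).carrier
  | 0 => X.left
  | n + 1 => (liftL.comp
      ((ContinuousLinearMap.compL ℂ A A _ (tmulL (E := A)
        (F := (chain A X.toBanachSp n).carrier))).comp (ContinuousLinearMap.mul ℂ A)) :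
      A →L[ℂ] ProjTensor A (chain A X.toBanachSp n).carrier →L[ℂ]
        ProjTensor A (chain A X.toBanachSp n).carrier)

/-- Right multiplication on the coefficients: `a ↦ (a₁ ⊗ ⋯ ⊗ aₙ ⊗ x ↦ a₁ ⊗ ⋯ ⊗ aₙ ⊗ x a)`. -/
def actRight : (n : ℕ) → A →L[ℂ] (chain A X.toBanachSp n).carrier →L[ℂ]
    (chain A X.toBanachSp n).carrier
  | 0 => X.right
  | n + 1 => idCons.comp (actRight n)

/-- The alternating sum of the multiplications of neighbours:
`a₁ ⊗ ⋯ ⊗ aₙ₊₁ ⊗ x ↦ ∑ₖ (-1)ᵏ⁻¹ a₁ ⊗ ⋯ ⊗ aₖaₖ₊₁ ⊗ ⋯ ⊗ x + (-1)ⁿ a₁ ⊗ ⋯ ⊗ aₙ ⊗ aₙ₊₁x`. -/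
def bar : (n : ℕ) → (chain A X.toBanachSp (n + 1)).carrier →L[ℂ]
    (chain A X.toBanachSp n).carrier
  | 0 => chainLift (actLeft X 0)
  | n + 1 => chainLift (actLeft X (n + 1)) - idCons (bar n)

/-- The differential
`a₁ ⊗ ⋯ ⊗ aₙ₊₁ ⊗ x ↦ a₂ ⊗ ⋯ ⊗ aₙ₊₁ ⊗ xa₁ + ∑ₖ (-1)ᵏ a₁ ⊗ ⋯ ⊗ aₖaₖ₊₁ ⊗ ⋯ ⊗ aₙ₊₁ ⊗ x
+ (-1)ⁿ⁺¹ a₁ ⊗ ⋯ ⊗ aₙ ⊗ aₙ₊₁x`, with `k` from `1` to `n`. -/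
def diff (n : ℕ) : (chain A X.toBanachSp (n + 1)).carrier →L[ℂ] (chain A X.toBanachSp n).carrier :=
  chainLift (actRight X n) - bar X n

variable {X}

theorem actLeft_zero (a : A) (x : X.carrier) : actLeft X 0 a x = X.left a x := rfl

theorem actLeft_succ (n : ℕ) (a a' : A) (c : (chain A X.toBanachSp n).carrier) :
    actLeft X (n + 1) a (cons n a' c) = cons n (a * a') c :=
  lift_tmul _ _ _

theorem actRight_zero (a : A) (x : X.carrier) : actRight X 0 a x = X.right a x := rfl

theorem actRight_succ (n : ℕ) (a a' : A) (c : (chain A X.toBanachSp n).carrier) :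
    actRight X (n + 1) a (cons n a' c) = cons n a' (actRight X n a c) :=
  idCons_cons _ _ _

theorem bar_zero_cons (a : A) (x : X.carrier) : bar X 0 (cons 0 a x) = X.left a x :=
  chainLift_cons (actLeft X 0) a x

theorem bar_succ_cons (n : ℕ) (a : A) (c : (chain A X.toBanachSp (n + 1)).carrier) :
    bar X (n + 1) (cons (n + 1) a c) = actLeft X (n + 1) a c - cons n a (bar X n c) := by
  simp [bar]

theorem diff_cons (n : ℕ) (a : A) (c : (chain A X.toBanachSp n).carrier) :
    diff X n (cons n a c) = actRight X n a c - bar X n (cons n a c) := by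
  simp [diff]

theorem actRight_elem (n : ℕ) (b : A) (a : Fin n → A) (x : X.carrier) :
    actRight X n b (elem n a x) = elem n a (X.right b x) := by
  induction n with
  | zero => rfl
  | succ n ih => exact (actRight_succ n b _ _).trans (congrArg _ (ih _))

theorem elem_succ {Y : BanachSp.{u}} (n : ℕ) (a : Fin (n + 1) → A) (x : Y.carrier) :
    elem (n + 1) a x = cons n (a 0) (elem n (Fin.tail a) x) := rfl

theorem bar_elem (n : ℕ) (a : Fin (n + 1) → A) (x : X.carrier) :
    bar X n (elem (n + 1) a x) =
      ∑ k : Fin n, (-1 : ℂ) ^ (k : ℕ) • elem n (Fin.contractNth k.castSucc (· * ·) a) x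
      + (-1 : ℂ) ^ n • elem n (Fin.init a) (X.left (a (Fin.last n)) x) := by
  induction n with
  | zero =>
    simp only [Finset.univ_eq_empty, Finset.sum_empty, zero_add, pow_zero, one_smul]
    exact bar_zero_cons (a 0) x
  | succ n ih =>
    rw [elem_succ, bar_succ_cons, ih, elem_succ, actLeft_succ, Fin.sum_univ_succ, map_add, map_sum]
    have h0 : elem (n + 1) (Fin.contractNth (Fin.castSucc 0) (· * ·) a) x =
        cons n (a 0 * Fin.tail a 0) (elem n (Fin.tail (Fin.tail a)) x) := by
      rw [elem_succ]
      rfl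
    have h1 : ∀ k : Fin n, elem (n + 1) (Fin.contractNth k.succ.castSucc (· * ·) a) x =
        cons n (a 0) (elem n (Fin.contractNth k.castSucc (· * ·) (Fin.tail a)) x) := by
      intro k
      rw [elem_succ]
      congr 2
      ext j
      rcases lt_trichotomy (j : ℕ) k with h | h | h <;>
        simp [Fin.contractNth, Fin.tail, h, h.le, not_lt.2, Nat.ne_of_gt]
    rw [h0]
    simp only [h1, Fin.val_succ, pow_succ, mul_neg, mul_one, neg_smul,
      Finset.sum_neg_distrib]
    rw [elem_succ n (Fin.init a)]
    simp only [sub_eq_add_neg, add_assoc, neg_add, Fin.val_zero, pow_zero, one_smul, map_smul]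
    rfl

/-- The differential on elementary tensors. Here `Fin.contractNth k (· * ·) a` replaces the two
neighbouring entries of `a` at the place `k` by their product. -/
theorem diff_elem (n : ℕ) (a : Fin (n + 1) → A) (x : X.carrier) :
    diff X n (elem (n + 1) a x) = elem n (Fin.tail a) (X.right (a 0) x)
      + ∑ k : Fin n, (-1 : ℂ) ^ (k + 1 : ℕ) • elem n (Fin.contractNth k.castSucc (· * ·) a) x
      + (-1 : ℂ) ^ (n + 1) • elem n (Fin.init a) (X.left (a (Fin.last n)) x) := by
  rw [elem_succ, diff_cons, ← elem_succ, actRight_elem, bar_elem, sub_eq_add_neg, neg_add,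
    add_assoc, ← Finset.sum_neg_distrib]
  simp only [pow_succ, mul_neg, mul_one, neg_smul]

theorem actLeft_mul (n : ℕ) (a a' : A) (c : (chain A X.toBanachSp n).carrier) :
    actLeft X n (a * a') c = actLeft X n a (actLeft X n a' c) := by
  cases n with
  | zero => exact X.left_mul a a' c
  | succ n =>
    have h : actLeft X (n + 1) (a * a') = (actLeft X (n + 1) a).comp (actLeft X (n + 1) a') :=
      chain_hom_ext fun b c => by simp [actLeft_succ, mul_assoc]
    exact congrArg (· c) h

theorem actRight_mul (n : ℕ) (a a' : A) (c : (chain A X.toBanachSp n).carrier) :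
    actRight X n (a * a') c = actRight X n a' (actRight X n a c) := by
  induction n with
  | zero => exact X.right_mul a a' c
  | succ n ih =>
    have h : actRight X (n + 1) (a * a') = (actRight X (n + 1) a').comp (actRight X (n + 1) a) :=
      chain_hom_ext fun b c => by simp [actRight_succ, ih]
    exact congrArg (· c) h

theorem actLeft_actRight (n : ℕ) (a b : A) (c : (chain A X.toBanachSp n).carrier) :
    actLeft X n a (actRight X n b c) = actRight X n b (actLeft X n a c) := by
  cases n with
  | zero => exact X.left_right a b c
  | succ n =>
    have h : (actLeft X (n + 1) a).comp (actRight X (n + 1) b) =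
        (actRight X (n + 1) b).comp (actLeft X (n + 1) a) :=
      chain_hom_ext fun b c => by simp [actRight_succ, actLeft_succ]
    exact congrArg (· c) h

theorem bar_actRight (n : ℕ) (b : A) (c : (chain A X.toBanachSp (n + 1)).carrier) :
    bar X n (actRight X (n + 1) b c) = actRight X n b (bar X n c) := by
  induction n with
  | zero =>
    have h : (bar X 0).comp (actRight X 1 b) = (actRight X 0 b).comp (bar X 0) :=
      chain_hom_ext fun a c => by
        simp only [ContinuousLinearMap.comp_apply, actRight_succ]
        exact ((bar_zero_cons _ _).trans (X.left_right a b c)).trans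
          (congrArg (X.right b) (bar_zero_cons _ _)).symm
    exact congrArg (· c) h
  | succ n ih =>
    have h : (bar X (n + 1)).comp (actRight X (n + 2) b) =
        (actRight X (n + 1) b).comp (bar X (n + 1)) :=
      chain_hom_ext fun a c => by
        simp only [ContinuousLinearMap.comp_apply, actRight_succ, bar_succ_cons, map_sub,
          actLeft_actRight, ih]
    exact congrArg (· c) h

theorem bar_actLeft (n : ℕ) (a : A) (c : (chain A X.toBanachSp (n + 1)).carrier) :
    bar X n (actLeft X (n + 1) a c) = actLeft X n a (bar X n c) := by
  have h : (bar X n).comp (actLeft X (n + 1) a) = (actLeft X n a).comp (bar X n) := by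
    refine chain_hom_ext fun b c => ?_
    simp only [ContinuousLinearMap.comp_apply, actLeft_succ]
    cases n with
    | zero =>
      exact ((bar_zero_cons _ _).trans (X.left_mul a b c)).trans
          (congrArg (X.left a) (bar_zero_cons _ _)).symm
    | succ n => simp only [bar_succ_cons, map_sub, actLeft_mul, actLeft_succ]
  exact congrArg (· c) h

theorem bar_bar (n : ℕ) (c : (chain A X.toBanachSp (n + 2)).carrier) :
    bar X n (bar X (n + 1) c) = 0 := by
  induction n with
  | zero =>
    have h : (bar X 0).comp (bar X 1) = 0 := chain_hom_ext fun a c => by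
      simp only [ContinuousLinearMap.comp_apply, bar_succ_cons, map_sub, bar_actLeft]
      exact sub_eq_zero.2 (bar_zero_cons a (bar X 0 c)).symm
    exact congrArg (· c) h
  | succ n ih =>
    have h : (bar X (n + 1)).comp (bar X (n + 2)) = 0 := chain_hom_ext fun a c => by
      simp [bar_succ_cons, bar_actLeft, ih]
    exact congrArg (· c) h

theorem diff_actLeft (n : ℕ) (a : A) (c : (chain A X.toBanachSp (n + 1)).carrier) :
    diff X n (actLeft X (n + 1) a c) = diff X n (actRight X (n + 1) a c) +
      actRight X n a (bar X n c) - actLeft X n a (bar X n c) := by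
  have h : (diff X n).comp (actLeft X (n + 1) a) = (diff X n).comp (actRight X (n + 1) a) +
      (actRight X n a).comp (bar X n) - (actLeft X n a).comp (bar X n) := by
    refine chain_hom_ext fun a' c => ?_
    have h1 := bar_actLeft n a (cons n a' c)
    have h2 := bar_actRight n a (cons n a' c)
    rw [actLeft_succ] at h1
    rw [actRight_succ] at h2
    simp only [ContinuousLinearMap.comp_apply, _root_.add_apply,
      _root_.sub_apply, actLeft_succ, actRight_succ, diff_cons, h1, h2, actRight_mul]
    abel
  exact congrArg (· c) h

/-- The differentials form a complex. -/
theorem diff_diff (n : ℕ) (c : (chain A X.toBanachSp (n + 2)).carrier) :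
    diff X n (diff X (n + 1) c) = 0 := by
  have h : (diff X n).comp (diff X (n + 1)) = 0 := chain_hom_ext fun a c => by
    have h1 := bar_bar n (cons (n + 1) a c)
    rw [bar_succ_cons, map_sub, bar_actLeft, sub_eq_zero] at h1
    simp only [ContinuousLinearMap.comp_apply, diff_cons, bar_succ_cons, map_sub, diff_actLeft,
      _root_.zero_apply, ← h1]
    abel
  exact congrArg (· c) h

variable (X)

/-- The `n`-cycles: the kernel of the differential that leaves the `n`-chains; all `0`-chains are
cycles. -/
def cycles : (n : ℕ) → Submodule ℂ (chain A X.toBanachSp n).carrier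
  | 0 => ⊤
  | n + 1 => LinearMap.ker (diff X n).toLinearMap

/-- The `n`-boundaries: the range (not its closure) of the differential into the `n`-chains. -/
def boundaries (n : ℕ) : Submodule ℂ (chain A X.toBanachSp n).carrier :=
  LinearMap.range (diff X n).toLinearMap

theorem boundaries_le_cycles (n : ℕ) : boundaries X n ≤ cycles X n := by
  cases n with
  | zero => exact le_top
  | succ n =>
    rintro _ ⟨c, rfl⟩
    exact diff_diff n c

/-- The homology group `Hₙ(A, X)`: cycles modulo boundaries. -/
abbrev homology (n : ℕ) : Type u := cycles X n ⧸ (boundaries X n).submoduleOf (cycles X n)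

end Homology

/-! ### Triangular Banach algebras -/

section Triangular

variable {A : Type u} {B : Type v} [NonUnitalNormedRing A] [NormedSpace ℂ A]
  [NonUnitalNormedRing B] [NormedSpace ℂ B]

/-- The matrices with rows `(a, m)` and `(0, b)`, where `a ∈ A`, `m ∈ M`, `b ∈ B`, with the norm
`‖a‖ + ‖m‖ + ‖b‖`. -/
def Tri (M : BanachBimodule.{u, v, w} A B) : Type (max u v w) :=
  WithLp 1 (A × WithLp 1 (M.carrier × B))

variable (M : BanachBimodule.{u, v, w} A B)

instance : NormedAddCommGroup (Tri M) :=
  inferInstanceAs (NormedAddCommGroup (WithLp 1 (A × WithLp 1 (M.carrier × B))))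

instance : NormedSpace ℂ (Tri M) :=
  inferInstanceAs (NormedSpace ℂ (WithLp 1 (A × WithLp 1 (M.carrier × B))))

instance [CompleteSpace A] [CompleteSpace B] : CompleteSpace (Tri M) :=
  inferInstanceAs (CompleteSpace (WithLp 1 (A × WithLp 1 (M.carrier × B))))

namespace Tri

variable {M}

/-- The matrix with rows `(a, m)` and `(0, b)`. -/
def mk (a : A) (m : M.carrier) (b : B) : Tri M := WithLp.toLp 1 (a, WithLp.toLp 1 (m, b))

/-- The upper left entry. -/
def a (t : Tri M) : A := WithLp.fst t

/-- The upper right entry. -/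
def m (t : Tri M) : M.carrier := WithLp.fst (WithLp.snd t)

/-- The lower right entry. -/
def b (t : Tri M) : B := WithLp.snd (WithLp.snd t)

@[ext]
theorem ext {s t : Tri M} (ha : s.a = t.a) (hm : s.m = t.m) (hb : s.b = t.b) : s = t :=
  WithLp.ofLp_injective 1 (Prod.ext ha (WithLp.ofLp_injective 1 (Prod.ext hm hb)))

@[simp] theorem mk_a (x : A) (y : M.carrier) (z : B) : (mk x y z).a = x := rfl
@[simp] theorem mk_m (x : A) (y : M.carrier) (z : B) : (mk x y z).m = y := rfl
@[simp] theorem mk_b (x : A) (y : M.carrier) (z : B) : (mk x y z).b = z := rfl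
@[simp] theorem zero_a : (0 : Tri M).a = 0 := rfl
@[simp] theorem zero_m : (0 : Tri M).m = 0 := rfl
@[simp] theorem zero_b : (0 : Tri M).b = 0 := rfl
@[simp] theorem add_a (s t : Tri M) : (s + t).a = s.a + t.a := rfl
@[simp] theorem add_m (s t : Tri M) : (s + t).m = s.m + t.m := rfl
@[simp] theorem add_b (s t : Tri M) : (s + t).b = s.b + t.b := rfl
@[simp] theorem smul_a (c : ℂ) (t : Tri M) : (c • t).a = c • t.a := rfl
@[simp] theorem smul_m (c : ℂ) (t : Tri M) : (c • t).m = c • t.m := rfl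
@[simp] theorem smul_b (c : ℂ) (t : Tri M) : (c • t).b = c • t.b := rfl

theorem norm_def (t : Tri M) : ‖t‖ = ‖t.a‖ + ‖t.m‖ + ‖t.b‖ := by
  have h1 := WithLp.prod_norm_eq_of_L1 (α := A) (β := WithLp 1 (M.carrier × B)) t
  have h2 := WithLp.prod_norm_eq_of_L1 (α := M.carrier) (β := B) (WithLp.snd t)
  rw [h2, ← add_assoc] at h1
  exact h1

/-- The matrix product. -/
instance : Mul (Tri M) :=
  ⟨fun s t => mk (s.a * t.a) (M.left s.a t.m + M.right t.b s.m) (s.b * t.b)⟩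

@[simp] theorem mul_a (s t : Tri M) : (s * t).a = s.a * t.a := rfl
@[simp] theorem mul_m (s t : Tri M) : (s * t).m = M.left s.a t.m + M.right t.b s.m := rfl
@[simp] theorem mul_b (s t : Tri M) : (s * t).b = s.b * t.b := rfl

theorem norm_mul_le (s t : Tri M) : ‖s * t‖ ≤ ‖s‖ * ‖t‖ := by
  simp only [norm_def, mul_a, mul_m, mul_b]
  have h1 := _root_.norm_mul_le s.a t.a
  have h2 := _root_.norm_mul_le s.b t.b
  have h3 := norm_add_le (M.left s.a t.m) (M.right t.b s.m)
  have h4 := M.norm_left_le s.a t.m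
  have h5 := M.norm_right_le t.b s.m
  have := norm_nonneg s.a
  have := norm_nonneg s.m
  have := norm_nonneg s.b
  have := norm_nonneg t.a
  have := norm_nonneg t.m
  have := norm_nonneg t.b
  have : 0 ≤ ‖s.a‖ * ‖t.b‖ := by positivity
  have : 0 ≤ ‖s.m‖ * ‖t.a‖ := by positivity
  have : 0 ≤ ‖s.m‖ * ‖t.m‖ := by positivity
  have : 0 ≤ ‖s.b‖ * ‖t.a‖ := by positivity
  have : 0 ≤ ‖s.b‖ * ‖t.m‖ := by positivity
  nlinarith

instance : NonUnitalNormedRing (Tri M) :=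
  { (inferInstance : NormedAddCommGroup (Tri M)) with
    left_distrib := fun s t u => by
      ext <;> simp [mul_add, add_add_add_comm]
    right_distrib := fun s t u => by
      ext <;> simp [add_mul, add_add_add_comm]
    zero_mul := fun t => by ext <;> simp
    mul_zero := fun t => by ext <;> simp
    mul_assoc := fun s t u => by
      ext <;> simp [mul_assoc, M.left_mul, M.right_mul, M.left_right, add_assoc]
    norm_mul_le := norm_mul_le }

instance [IsScalarTower ℂ A A] [IsScalarTower ℂ B B] : IsScalarTower ℂ (Tri M) (Tri M) :=
  ⟨fun c s t => by
    change (c • s) * t = c • (s * t)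
    ext <;> simp [smul_mul_assoc]⟩

instance [SMulCommClass ℂ A A] [SMulCommClass ℂ B B] : SMulCommClass ℂ (Tri M) (Tri M) :=
  ⟨fun c s t => by
    change c • (s * t) = s * (c • t)
    ext <;> simp [mul_smul_comm]⟩

variable (M)

/-- The upper left entry, as a bounded linear map. -/
def aL : Tri M →L[ℂ] A :=
  LinearMap.mkContinuous ⟨⟨a, add_a⟩, smul_a⟩ 1 fun t => by
    change ‖t.a‖ ≤ 1 * ‖t‖
    rw [norm_def]
    linarith [norm_nonneg t.m, norm_nonneg t.b]

/-- The lower right entry, as a bounded linear map. -/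
def bL : Tri M →L[ℂ] B :=
  LinearMap.mkContinuous ⟨⟨b, add_b⟩, smul_b⟩ 1 fun t => by
    change ‖t.b‖ ≤ 1 * ‖t‖
    rw [norm_def]
    linarith [norm_nonneg t.m, norm_nonneg t.a]

end Tri

/-- An `A`-`B`-bimodule `X` as a bimodule over the triangular algebra: for `t` with rows `(a, m)`
and `(0, b)`, `t · x = a · x` and `x · t = x · b`. For `X = M` this is `M` as the upper right corner
of the triangular algebra. -/
def overTri (M : BanachBimodule.{u, v, w} A B) (X : BanachBimodule.{u, v, w} A B) :
    BanachBimodule.{max u v w, max u v w, w} (Tri M) (Tri M) where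
  toBanachSp := X.toBanachSp
  left := X.left.comp (Tri.aL M)
  right := X.right.comp (Tri.bL M)
  left_mul s t x := X.left_mul s.a t.a x
  right_mul s t x := X.right_mul s.b t.b x
  left_right s t x := X.left_right s.a t.b x
  norm_left_le t x := (X.norm_left_le t.a x).trans <| by
    gcongr
    rw [Tri.norm_def]
    linarith [norm_nonneg t.m, norm_nonneg t.b]
  norm_right_le t x := (X.norm_right_le t.b x).trans <| by
    gcongr
    rw [Tri.norm_def]
    linarith [norm_nonneg t.m, norm_nonneg t.a]

theorem norm_cornerLeft_le (x : A) (t : Tri M) :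
    ‖(Tri.mk (x * t.a) (M.left x t.m) 0 : Tri M)‖ ≤ 1 * ‖x‖ * ‖t‖ := by
  simp only [Tri.norm_def, Tri.mk_a, Tri.mk_m, Tri.mk_b, norm_zero]
  have h1 := norm_mul_le x t.a
  have h2 := M.norm_left_le x t.m
  have h3 : 0 ≤ ‖x‖ * ‖t.b‖ := by positivity
  linarith

theorem norm_cornerRight_le (y : B) (t : Tri M) :
    ‖(Tri.mk 0 (M.right y t.m) (t.b * y) : Tri M)‖ ≤ 1 * ‖y‖ * ‖t‖ := by
  simp only [Tri.norm_def, Tri.mk_a, Tri.mk_m, Tri.mk_b, norm_zero]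
  have h1 := norm_mul_le t.b y
  have h2 := M.norm_right_le y t.m
  have h3 : 0 ≤ ‖y‖ * ‖t.a‖ := by positivity
  linarith

theorem mk_overTri_left (t : Tri M) (x : M.carrier) :
    (Tri.mk 0 ((overTri M M).left t x) 0 : Tri M) = t * Tri.mk 0 x 0 := by
  ext
  · exact (mul_zero t.a).symm
  · change M.left t.a x = M.left t.a x + M.right 0 t.m
    simp
  · exact (mul_zero t.b).symm

theorem mk_overTri_right (t : Tri M) (x : M.carrier) :
    (Tri.mk 0 ((overTri M M).right t x) 0 : Tri M) = Tri.mk 0 x 0 * t := by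
  ext
  · exact (zero_mul t.a).symm
  · change M.right t.b x = M.left 0 t.m + M.right t.b x
    simp
  · exact (zero_mul t.b).symm

/-- The triangular algebra of `M` as an `A`-`B`-bimodule, by matrix multiplication with the corners
`A` and `B` inside it: `x · t` and `t · y` are the products of `t` with the matrix whose only
non-zero entry is `x` in the upper left, respectively `y` in the lower right, corner. -/
def triBimodule [CompleteSpace A] [CompleteSpace B] [IsScalarTower ℂ A A] [SMulCommClass ℂ A A]
    [IsScalarTower ℂ B B] [SMulCommClass ℂ B B] (M : BanachBimodule.{u, v, w} A B) :
    BanachBimodule.{u, v, max u v w} A B where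
  carrier := Tri M
  left := LinearMap.mkContinuous₂
    (LinearMap.mk₂ ℂ (fun x t => (Tri.mk (x * t.a) (M.left x t.m) 0 : Tri M))
      (fun x y t => by ext <;> simp [add_mul]) (fun c x t => by ext <;> simp [smul_mul_assoc])
      (fun x s t => by ext <;> simp [mul_add]) (fun c x t => by ext <;> simp [mul_smul_comm])) 1
    (norm_cornerLeft_le M)
  right := LinearMap.mkContinuous₂
    (LinearMap.mk₂ ℂ (fun y t => (Tri.mk 0 (M.right y t.m) (t.b * y) : Tri M))
      (fun x y t => by ext <;> simp [mul_add]) (fun c x t => by ext <;> simp [mul_smul_comm])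
      (fun x s t => by ext <;> simp [add_mul]) (fun c x t => by ext <;> simp [smul_mul_assoc])) 1
    (norm_cornerRight_le M)
  left_mul x y t := by
    ext
    · exact mul_assoc x y t.a
    · exact M.left_mul x y t.m
    · rfl
  right_mul x y t := by
    ext
    · rfl
    · exact M.right_mul x y t.m
    · exact (mul_assoc t.b x y).symm
  left_right x y t := by
    ext
    · exact mul_zero x
    · exact M.left_right x y t.m
    · exact (zero_mul y).symm
  norm_left_le x t := (norm_cornerLeft_le M x t).trans_eq (by rw [one_mul])
  norm_right_le y t := (norm_cornerRight_le M y t).trans_eq (by rw [one_mul])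

theorem triBimodule_left (M : BanachBimodule.{u, v, w} A B) [CompleteSpace A] [CompleteSpace B]
    [IsScalarTower ℂ A A] [SMulCommClass ℂ A A] [IsScalarTower ℂ B B] [SMulCommClass ℂ B B]
    (x : A) (t : Tri M) : (triBimodule M).left x t = (Tri.mk x 0 0 * t : Tri M) := by
  refine Tri.ext (M := M) ?_ ?_ ?_
  · rfl
  · change M.left x t.m = M.left x t.m + M.right t.b 0
    simp
  · exact (zero_mul t.b).symm

theorem triBimodule_right (M : BanachBimodule.{u, v, w} A B) [CompleteSpace A] [CompleteSpace B]
    [IsScalarTower ℂ A A] [SMulCommClass ℂ A A] [IsScalarTower ℂ B B] [SMulCommClass ℂ B B]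
    (y : B) (t : Tri M) : (triBimodule M).right y t = (t * Tri.mk 0 0 y : Tri M) := by
  refine Tri.ext (M := M) ?_ ?_ ?_
  · exact (mul_zero t.a).symm
  · change M.right y t.m = M.left t.a 0 + M.right y t.m
    simp
  · rfl

/-- The iterated construction: `tower M 0` is the triangular algebra of `M`, and
`tower M (m + 1)` is the triangular algebra of the `A`-`B`-bimodule `tower M m`. -/
def tower {A B : Type u} [NonUnitalNormedRing A] [NormedSpace ℂ A]
    [NonUnitalNormedRing B] [NormedSpace ℂ B] [CompleteSpace A] [CompleteSpace B]
    [IsScalarTower ℂ A A] [SMulCommClass ℂ A A]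
    [IsScalarTower ℂ B B] [SMulCommClass ℂ B B] (M : BanachBimodule.{u, u, u} A B) :
    ℕ → BanachBimodule.{u, u, u} A B
  | 0 => triBimodule M
  | m + 1 => triBimodule (tower M m)

end Triangular

end TriBanach
end

namespace TriBanach

/-! ### A contracting homotopy built from the two diagonal units -/

section Contraction

variable {T : Type u} [NonUnitalNormedRing T] [NormedSpace ℂ T] [IsScalarTower ℂ T T]
  [SMulCommClass ℂ T T]

/-! Let p and q be the matrices with the unit of A, respectively of B, as their only non-zero entry.
Since M is unital, p + q is a left identity of T, and triangularity gives q t p = 0 and q t q = q t.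
On coefficients acted on through the diagonal, q is zero from the left and p is zero from the right.

If p were a left identity, s c = -p ⊗ c would satisfy bar s + s bar = -id in positive degrees, and
the face t ⊗ c ↦ c · t would kill it because p acts by zero from the right. The defect is p t = t -
q t. The recursive term -q t ⊗ s c in `contraction` repairs it, so that the identity for `bar` does
hold (`bar_contraction`). Under the remaining face this term yields -(s c) · t, which cancels s (c ·
t) because s commutes with the right action on coefficients (`contraction_actRight`). As `diff` is
that face minus `bar`, the result is diff s + s diff = id in positive degrees.

In degree 0 the homotopy gives p x + (x - p x) q, so what is needed is that this equals x. It does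
for M, and the property passes from X to the triangular algebra of X even though that bimodule is in
general not unital. This handles the whole tower. Since s is a bounded map on the completed tensor
products, every cycle is an actual boundary and no closure enters. -/

/-- A pair of elements of `T` that behaves like the two diagonal idempotents of a triangular
algebra, together with a bimodule on which `q` acts by zero from the left, `p` by zero from the
right, and no non-zero part is killed by both `p` from the left and `q` from the right. -/
structure IsTriangularPair (X : BanachBimodule.{u, u, u} T T) (p q : T) : Prop where
  add_mul : ∀ t, p * t + q * t = t
  mul_left_zero : ∀ t, q * t * p = 0
  mul_right_self : ∀ t, q * t * q = q * t
  left_zero : ∀ x, X.left q x = 0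
  right_zero : ∀ x, X.right p x = 0
  complement : ∀ x, X.left p x + X.right q (x - X.left p x) = x

/-- The contracting homotopy `x ↦ -p ⊗ x + q ⊗ (x - p x)`,
`t ⊗ c ↦ -p ⊗ t ⊗ c - q t ⊗ s c`. -/
noncomputable def contraction (X : BanachBimodule.{u, u, u} T T) (p q : T) : (n : ℕ) →
    (chain T X.toBanachSp n).carrier →L[ℂ] (chain T X.toBanachSp (n + 1)).carrier
  -- The part x - p x is invisible to p from the left; placed behind q it is recovered by the right
  -- action of q, while `bar` does not see it because q acts by zero from the left.
  | 0 => (cons 0 q).comp (ContinuousLinearMap.id ℂ _ - actLeft X 0 p) - cons 0 p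
  | n + 1 => -cons (n + 1) p - (idCons (contraction X p q n)).comp (actLeft X (n + 1) q)

variable {X : BanachBimodule.{u, u, u} T T} {p q : T}

theorem contraction_zero_apply (x : (chain T X.toBanachSp 0).carrier) :
    contraction X p q 0 x = cons 0 q (x - actLeft X 0 p x) - cons 0 p x := rfl

theorem bar_zero_cons_eq_actLeft (t : T) (x : (chain T X.toBanachSp 0).carrier) :
    bar X 0 (cons 0 t x) = actLeft X 0 t x := bar_zero_cons t x

theorem contraction_succ_cons (n : ℕ) (t : T) (c : (chain T X.toBanachSp n).carrier) :
    contraction X p q (n + 1) (cons n t c) =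
      -cons (n + 1) p (cons n t c) - cons (n + 1) (q * t) (contraction X p q n c) := by
  change -cons (n + 1) p (cons n t c) -
    idCons (contraction X p q n) (actLeft X (n + 1) q (cons n t c)) = _
  rw [actLeft_succ, idCons_cons]

/-- The homotopy inserts tensor factors on the left and touches the coefficient only through the
left action of p, which commutes with the right action. -/
theorem contraction_actRight (n : ℕ) (t : T) (c : (chain T X.toBanachSp n).carrier) :
    contraction X p q n (actRight X n t c) = actRight X (n + 1) t (contraction X p q n c) := by
  induction n with
  | zero =>
    rw [contraction_zero_apply, contraction_zero_apply, map_sub (actRight X (0 + 1) t),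
      actRight_succ, actRight_succ, actLeft_actRight, map_sub (actRight X 0 t)]
  | succ n ih =>
    have h : (contraction X p q (n + 1)).comp (actRight X (n + 1) t) =
        (actRight X (n + 1 + 1) t).comp (contraction X p q (n + 1)) := chain_hom_ext fun a c => by
      simp only [ContinuousLinearMap.comp_apply, actRight_succ, contraction_succ_cons, map_sub,
        map_neg, ih]
    exact congrArg (· c) h

/-! ### The homotopy identities for `bar` and `diff` -/

namespace IsTriangularPair

variable (H : IsTriangularPair X p q)
include H

theorem actRight_eq_zero (n : ℕ) (c : (chain T X.toBanachSp n).carrier) :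
    actRight X n p c = 0 := by
  induction n with
  | zero => exact H.right_zero c
  | succ n ih =>
    have h : actRight X (n + 1) p = 0 := chain_hom_ext fun a c => by
      rw [actRight_succ, ih, map_zero]; rfl
    exact congrArg (· c) h

/-- Split t = p t + q t: acting by p t from the right means acting by p first, which gives zero. -/
theorem actRight_mul_left (n : ℕ) (t : T) (c : (chain T X.toBanachSp n).carrier) :
    actRight X n (q * t) c = actRight X n t c := by
  conv_rhs => rw [← H.add_mul t, map_add, _root_.add_apply, actRight_mul n p,
    H.actRight_eq_zero, map_zero, zero_add]

theorem cons_mul_add (n : ℕ) (t : T) (c : (chain T X.toBanachSp n).carrier) :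
    cons n (p * t) c + cons n (q * t) c = cons n t c := by
  rw [← _root_.add_apply, ← map_add, H.add_mul]

theorem actLeft_eq_zero (x : (chain T X.toBanachSp 0).carrier) : actLeft X 0 q x = 0 :=
  H.left_zero x

/-- In t = p t + q t the second summand acts by zero from the left, so p is the identity on every t
· x, though perhaps not on all of X. -/
theorem actLeft_actLeft (t : T) (x : (chain T X.toBanachSp 0).carrier) :
    actLeft X 0 p (actLeft X 0 t x) = actLeft X 0 t x := by
  conv_rhs => rw [← H.add_mul t, map_add, _root_.add_apply, actLeft_mul, actLeft_mul 0 q,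
    H.actLeft_eq_zero, add_zero]

/-- Here q t p = 0 removes the term starting with p and q t q = q t simplifies the other one. -/
theorem actLeft_contraction_zero (t : T) (x : (chain T X.toBanachSp 0).carrier) :
    actLeft X (0 + 1) (q * t) (contraction X p q 0 x) =
      cons 0 (q * t) (x - actLeft X 0 p x) := by
  rw [contraction_zero_apply, map_sub (actLeft X (0 + 1) (q * t)), actLeft_succ, actLeft_succ,
    H.mul_left_zero, H.mul_right_self, map_zero (cons 0), _root_.zero_apply, sub_zero]

/-- On a ⊗ c both sides equal -(q t a) ⊗ s c: on the left q t p = 0 and q t q = q t, on the right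
the added term cancels the part of s that starts with p. -/
theorem actLeft_contraction_succ (n : ℕ) (t : T) (c : (chain T X.toBanachSp (n + 1)).carrier) :
    actLeft X (n + 1 + 1) (q * t) (contraction X p q (n + 1) c) =
      contraction X p q (n + 1) (actLeft X (n + 1) t c) +
        cons (n + 1) p (actLeft X (n + 1) t c) := by
  have h : (actLeft X (n + 1 + 1) (q * t)).comp (contraction X p q (n + 1)) =
      (contraction X p q (n + 1)).comp (actLeft X (n + 1) t) +
        (cons (n + 1) p).comp (actLeft X (n + 1) t) := chain_hom_ext fun a c => by
    simp only [ContinuousLinearMap.comp_apply, _root_.add_apply, contraction_succ_cons,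
      actLeft_succ, map_sub, map_neg, H.mul_left_zero, map_zero, _root_.zero_apply]
    rw [← mul_assoc (q * t), H.mul_right_self, mul_assoc]
    abel
  exact congrArg (· c) h

theorem bar_contraction_zero (x : (chain T X.toBanachSp 0).carrier) :
    bar X 0 (contraction X p q 0 x) = -actLeft X 0 p x := by
  rw [contraction_zero_apply, map_sub (bar X 0), bar_zero_cons_eq_actLeft,
    bar_zero_cons_eq_actLeft, H.actLeft_eq_zero, zero_sub]

/-- The correction x - p x vanishes on elements t · x, so there the degree 0 homotopy has the same
shape as the naive one. -/
theorem contraction_actLeft (t : T) (x : (chain T X.toBanachSp 0).carrier) :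
    contraction X p q 0 (actLeft X 0 t x) = -cons 0 p (actLeft X 0 t x) := by
  rw [contraction_zero_apply, H.actLeft_actLeft, sub_self, map_zero (cons 0 q), zero_sub]

/-- Induction on the degree. Expanding on t ⊗ c, the terms -(p t) ⊗ c and -(q t) ⊗ c add up to -t ⊗
c, and the rest assembles to -s (bar (t ⊗ c)). -/
theorem bar_contraction (n : ℕ) (c : (chain T X.toBanachSp (n + 1)).carrier) :
    bar X (n + 1) (contraction X p q (n + 1) c) = -contraction X p q n (bar X n c) - c := by
  induction n with
  | zero =>
    have h : (bar X (0 + 1)).comp (contraction X p q (0 + 1)) =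
        -(contraction X p q 0).comp (bar X 0) - ContinuousLinearMap.id ℂ _ :=
      chain_hom_ext fun t x => by
        change bar X (0 + 1) (contraction X p q (0 + 1) (cons 0 t x)) =
          -contraction X p q 0 (bar X 0 (cons 0 t x)) - cons 0 t x
        rw [contraction_succ_cons, map_sub (bar X (0 + 1)), map_neg (bar X (0 + 1)), bar_succ_cons,
          bar_succ_cons, actLeft_succ, H.actLeft_contraction_zero, H.bar_contraction_zero, bar_zero_cons_eq_actLeft, H.contraction_actLeft]
        -- The two occurrences of q t ⊗ p x, one from the correction in degree 0 and one from
        -- `bar_contraction_zero`, cancel.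
        rw [← H.cons_mul_add 0 t x, map_sub (cons 0 (q * t)), map_neg (cons 0 (q * t))]
        abel
    exact congrArg (· c) h
  | succ n ih =>
    have h : (bar X (n + 1 + 1)).comp (contraction X p q (n + 1 + 1)) =
        -(contraction X p q (n + 1)).comp (bar X (n + 1)) - ContinuousLinearMap.id ℂ _ :=
      chain_hom_ext fun t c => by
        change bar X (n + 1 + 1) (contraction X p q (n + 1 + 1) (cons (n + 1) t c)) =
          -contraction X p q (n + 1) (bar X (n + 1) (cons (n + 1) t c)) - cons (n + 1) t c
        rw [contraction_succ_cons, map_sub (bar X (n + 1 + 1)), map_neg (bar X (n + 1 + 1)),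
          bar_succ_cons (n + 1), bar_succ_cons (n + 1), actLeft_succ, H.actLeft_contraction_succ, ih,
          bar_succ_cons, map_sub (contraction X p q (n + 1)),
          contraction_succ_cons]
        -- The induction hypothesis turns q t ⊗ bar (s c) into -(q t) ⊗ s (bar c) - q t ⊗ c; its
        -- last part completes p t ⊗ c to t ⊗ c.
        rw [← H.cons_mul_add (n + 1) t c]
        simp only [map_sub, map_neg]
        abel
    exact congrArg (· c) h

/-- The right action sends q ⊗ (x - p x) to (x - p x) q and kills p ⊗ x, while -`bar` contributes p
x; `complement` says that the sum is x. -/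
theorem diff_contraction_zero (x : (chain T X.toBanachSp 0).carrier) :
    diff X 0 (contraction X p q 0 x) = x := by
  have h := H.bar_contraction_zero x
  rw [diff, _root_.sub_apply, h, contraction_zero_apply, map_sub (chainLift (actRight X 0)),
    chainLift_cons, chainLift_cons, H.actRight_eq_zero, sub_zero, sub_neg_eq_add, add_comm]
  exact H.complement x

theorem diff_contraction_succ (n : ℕ) (c : (chain T X.toBanachSp (n + 1)).carrier) :
    diff X (n + 1) (contraction X p q (n + 1) c) + contraction X p q n (diff X n c) = c := by
  have h : (diff X (n + 1)).comp (contraction X p q (n + 1)) +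
      (contraction X p q n).comp (diff X n) = ContinuousLinearMap.id ℂ _ :=
    chain_hom_ext fun t c => by
      change diff X (n + 1) (contraction X p q (n + 1) (cons n t c)) +
        contraction X p q n (diff X n (cons n t c)) = cons n t c
      rw [diff, _root_.sub_apply, H.bar_contraction, diff_cons, contraction_succ_cons]
      -- Of the right action on s (t ⊗ c) only -(s c) · t survives, and it cancels s (c · t); the
      -- two copies of s (bar (t ⊗ c)) cancel as well.
      simp only [map_sub, map_neg, chainLift_cons, H.actRight_eq_zero, H.actRight_mul_left,
        contraction_actRight]
      abel
  exact congrArg (· c) h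

theorem subsingleton_homology (n : ℕ) : Subsingleton (homology X n) := by
  rw [Submodule.Quotient.subsingleton_iff, Submodule.submoduleOf, Submodule.comap_subtype_eq_top]
  intro c hc
  cases n with
  | zero => exact ⟨contraction X p q 0 c, H.diff_contraction_zero c⟩
  | succ n =>
    refine ⟨contraction X p q (n + 1) c, ?_⟩
    have h := H.diff_contraction_succ n c
    -- In positive degree `cycles` is a kernel, so `hc` is the cycle equation by unfolding.
    rwa [show diff X n c = 0 from hc, map_zero, add_zero] at h

end IsTriangularPair

end Contraction

/-! ### The unit condition along the tower, and the pair in the triangular algebra -/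

section Tower

variable {A B : Type u} [NormedRing A] [NormedAlgebra ℂ A] [NormedRing B] [NormedAlgebra ℂ B]

/-- No non-zero part of the bimodule is killed by both units: `1 x + x 1 - 1 x 1 = x`. -/
def IsUnitCovered (X : BanachBimodule.{u, u, u} A B) : Prop :=
  ∀ x, X.left 1 x + X.right 1 (x - X.left 1 x) = x

theorem BanachBimodule.IsUnital.isUnitCovered {M : BanachBimodule.{u, u, u} A B}
    (hM : M.IsUnital) : IsUnitCovered M := fun x => by
  rw [hM.1, sub_self, map_zero, add_zero]

variable [CompleteSpace A] [CompleteSpace B]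

/-- Checked entrywise: the left unit fixes the entry in A and kills the one in B, the right unit
recovers the entry in B, and the corner entry is the condition for X itself. -/
theorem IsUnitCovered.triBimodule {X : BanachBimodule.{u, u, u} A B} (hX : IsUnitCovered X) :
    IsUnitCovered (triBimodule X) := fun t => by
  refine Tri.ext (M := X) ?_ ?_ ?_
  · change 1 * Tri.a t + 0 = Tri.a t
    rw [one_mul, add_zero]
  · exact hX (Tri.m t)
  · change 0 + (Tri.b t - 0) * 1 = Tri.b t
    rw [zero_add, sub_zero, mul_one]

theorem IsUnitCovered.tower {M : BanachBimodule.{u, u, u} A B} (hM : IsUnitCovered M) (m : ℕ) :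
    IsUnitCovered (tower M m) := by
  induction m with
  | zero => exact hM.triBimodule
  | succ m ih => exact ih.triBimodule

omit [CompleteSpace A] [CompleteSpace B] in
theorem isTriangularPair_overTri {M X : BanachBimodule.{u, u, u} A B} (hM : M.IsUnital)
    (hX : IsUnitCovered X) :
    IsTriangularPair (overTri M X) (Tri.mk 1 0 0) (Tri.mk 0 0 1) where
  -- The corner entry of p t + q t is 1 · m, so this is where the left unit must fix M.
  add_mul t := by ext <;> simp [hM.1]
  mul_left_zero t := by ext <;> simp
  mul_right_self t := by ext <;> simp
  left_zero x := by
    change X.left 0 x = 0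
    rw [map_zero]
    rfl
  right_zero x := by
    change X.right 0 x = 0
    rw [map_zero]
    rfl
  -- Through the diagonal, p acts from the left as the unit of A and q from the right as the unit of
  -- B, so the two conditions agree by definition.
  complement := hX

end Tower

end TriBanach

theorem corollary3p5 {A B : Type u} [NormedRing A] [NormedAlgebra ℂ A] [CompleteSpace A]
    [NormedRing B] [NormedAlgebra ℂ B] [CompleteSpace B]
    (M : TriBanach.BanachBimodule.{u, u, u} A B) (hM : M.IsUnital) :
    (∀ n : ℕ, Subsingleton (TriBanach.homology (TriBanach.overTri M M) n)) ∧
      ∀ m n : ℕ, Subsingleton (TriBanach.homology (TriBanach.overTri M (TriBanach.tower M m)) n) :=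
  ⟨(TriBanach.isTriangularPair_overTri hM hM.isUnitCovered).subsingleton_homology,
    fun m => (TriBanach.isTriangularPair_overTri hM
      (hM.isUnitCovered.tower m)).subsingleton_homology⟩
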